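/- Let $X$ be a random vector in $\mathbb{R}^d$, $M$ a random vector in $\{0,1\}^d$ and $Y$ a real random variable, and let $\widetilde X\in(\mathbb{R}\cup\{\mathtt{NA}\})^d$ be the incomplete vector with $\widetilde X_k=\mathtt{NA}$ if $M_k=1$ and $\widetilde X_k=X_k$ if $M_k=0$. For $m\in\{0,1\}^d$ let $obs=\{k:m_k=0\}$ and $mis=\{k:m_k=1\}$; these indices on a vector or matrix denote the corresponding sub-vector or block (a single index on a matrix denotes the principal block). Assume: 1. (Linear model) $Y=\beta_0^\star+\langle X,\beta^\star\rangle+\varepsilon$ with $\beta_0^\star\in\mathbb{R}$, $\beta^\star\in\mathbb{R}^d$, $\varepsilon\sim\mathcal N(0,\sigma^2)$, and $\varepsilon$ independent of $(X,M)$. 2. (Gaussian data) $X\sim\mathcal N(\mu,\Sigma)$ with $\Sigma$ positive definite. 3. (Gaussian self-masking) Almost surely, $P(M=m\mid X)=\prod_{k=1}^d P(M_k=m_k\mid X_k)$ for every $m\in\{0,1\}^d$, and for every $k$, $$P(M_k=1\mid X_k)=K_k\exp\left(-\frac12\,\frac{(X_k-\widetilde\mu_k)^2}{\widetilde\sigma_k^2}\right),\qquad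 0<K_k<1,\ \widetilde\mu_k\in\mathbb{R},\ \widetilde\sigma_k\neq0.$$ Let $\Sigma_{mis|obs}=\Sigma_{mis,mis}-\Sigma_{mis,obs}\Sigma_{obs}^{-1}\Sigma_{obs,mis}$ and $D=\mathrm{diag}(\widetilde\sigma_1^2,\dots,\widetilde\sigma_d^2)$. Then for every pattern $m$ the matrices $\Sigma_{obs}$, $\Sigma_{mis|obs}$ and $Id+D_{mis}\Sigma_{mis|obs}^{-1}$ are invertible. Moreover $Y$ is integrable, and with $obs=obs(M)$, $mis=mis(M)$ and $$f^\star(X_{obs},M)=\beta_0^\star+\langle\beta^\star_{obs},X_{obs}\rangle+\Big\langle\beta^\star_{mis},\,(Id+D_{mis}\Sigma_{mis|obs}^{-1})^{-1}\Big(\widetilde\mu_{mis}+D_{mis}\Sigma_{mis|obs}^{-1}\big(\mu_{mis}+\Sigma_{mis,obs}\Sigma_{obs}^{-1}(X_{obs}-\mu_{obs})\big)\Big)\Big\rangle,$$ we have $\mathbb{E}[Y\mid\widetilde X]=f^\star(X_{obs},M)$ almost surely. A Bayes predictor for the squared loss, that is, a minimizer $f$ of $\mathbb{E}[(Y-f(\widetilde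 X))^2]$ over all measurable $f:(\mathbb{R}\cup\{\mathtt{NA}\})^d\to\mathbb{R}$, exists, and every such $f$ satisfies $f(\widetilde X)=f^\star(X_{obs},M)$ almost surely. -/

import Mathlib

open MeasureTheory ProbabilityTheory
open scoped ENNReal NNReal Matrix

namespace MissingData

/-- A missingness pattern `m ∈ {0,1}^d`: `m k = true` means that coordinate `k` is missing. -/
abbrev Pattern (d : ℕ) := Fin d → Bool

/-- The indices that are observed under the pattern `m`. -/
abbrev Obs {d : ℕ} (m : Pattern d) := {k : Fin d // m k = false}

/-- The indices that are missing under the pattern `m`. -/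
abbrev Mis {d : ℕ} (m : Pattern d) := {k : Fin d // m k = true}

/-- The space `(ℝ ∪ {NA})^d` of incomplete vectors; the point `NA` is `Sum.inr ()`. It carries the
product of the disjoint-union sigma-algebras. -/
abbrev Incomplete (d : ℕ) := Fin d → ℝ ⊕ Unit

/-- The incomplete vector obtained from `x` by masking the coordinates that are missing in `m`. -/
def mask {d : ℕ} (m : Pattern d) (x : EuclideanSpace ℝ (Fin d)) : Incomplete d :=
  fun k => if m k = true then Sum.inr () else Sum.inl (x k)

section Blocks

variable {d : ℕ}

/-- The block `A_obs` of `A`. -/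
def blockObs (A : Matrix (Fin d) (Fin d) ℝ) (m : Pattern d) : Matrix (Obs m) (Obs m) ℝ :=
  A.submatrix Subtype.val Subtype.val

/-- The block `A_{mis,mis}` of `A`. -/
def blockMis (A : Matrix (Fin d) (Fin d) ℝ) (m : Pattern d) : Matrix (Mis m) (Mis m) ℝ :=
  A.submatrix Subtype.val Subtype.val

/-- The block `A_{mis,obs}` of `A`. -/
def blockMisObs (A : Matrix (Fin d) (Fin d) ℝ) (m : Pattern d) : Matrix (Mis m) (Obs m) ℝ :=
  A.submatrix Subtype.val Subtype.val

/-- The block `A_{obs,mis}` of `A`. -/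
def blockObsMis (A : Matrix (Fin d) (Fin d) ℝ) (m : Pattern d) : Matrix (Obs m) (Mis m) ℝ :=
  A.submatrix Subtype.val Subtype.val

/-- The sub-vector `v_obs` of `v`. -/
def vecObs (v : EuclideanSpace ℝ (Fin d)) (m : Pattern d) : Obs m → ℝ := fun k => v k

/-- The sub-vector `v_mis` of `v`. -/
def vecMis (v : EuclideanSpace ℝ (Fin d)) (m : Pattern d) : Mis m → ℝ := fun k => v k

/-- The Schur complement `S_{mis|obs} = S_{mis,mis} - S_{mis,obs} S_obs⁻¹ S_{obs,mis}`. -/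
noncomputable def condCov (S : Matrix (Fin d) (Fin d) ℝ) (m : Pattern d) :
    Matrix (Mis m) (Mis m) ℝ :=
  blockMis S m - blockMisObs S m * (blockObs S m)⁻¹ * blockObsMis S m

/-- The vector `μ_mis + S_{mis,obs} S_obs⁻¹ (x_obs - μ_obs)`. -/
noncomputable def condMean (μ : EuclideanSpace ℝ (Fin d)) (S : Matrix (Fin d) (Fin d) ℝ)
    (m : Pattern d) (xobs : Obs m → ℝ) : Mis m → ℝ :=
  vecMis μ m + (blockMisObs S m * (blockObs S m)⁻¹) *ᵥ (xobs - vecObs μ m)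

/-- The matrix `D = diag(σ̃₁², …, σ̃_d²)`. -/
def maskCov (σt : Fin d → ℝ) : Matrix (Fin d) (Fin d) ℝ := Matrix.diagonal fun k => σt k ^ 2

/-- The predictor
`β₀ + ⟨β_obs, x_obs⟩ + ⟨β_mis, (Id + D_mis S_{mis|obs}⁻¹)⁻¹ (μ̃_mis + D_mis S_{mis|obs}⁻¹
(μ_mis + S_{mis,obs} S_obs⁻¹ (x_obs - μ_obs)))⟩` as a function of the pattern `m` and `x_obs`. -/
noncomputable def selfMaskingPredictor (β₀ : ℝ) (β μ : EuclideanSpace ℝ (Fin d))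
    (S : Matrix (Fin d) (Fin d) ℝ) (μt : EuclideanSpace ℝ (Fin d)) (σt : Fin d → ℝ)
    (m : Pattern d) (xobs : Obs m → ℝ) : ℝ :=
  β₀ + vecObs β m ⬝ᵥ xobs +
    vecMis β m ⬝ᵥ ((1 + blockMis (maskCov σt) m * (condCov S m)⁻¹)⁻¹ *ᵥ
      (vecMis μt m + (blockMis (maskCov σt) m * (condCov S m)⁻¹) *ᵥ condMean μ S m xobs))

end Blocks

section Probability

variable {Ω : Type*} [MeasurableSpace Ω] {d : ℕ}

/-- Gaussian self-masking: `P(M = m | X) = ∏ₖ P(Mₖ = mₖ | Xₖ)` for every pattern `m`, and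
`P(Mₖ = 1 | Xₖ) = Kₖ exp(-(Xₖ - μ̃ₖ)² / (2 σ̃ₖ²))` for every `k`, almost surely. -/
structure IsGaussianSelfMasking (P : Measure Ω) (X : Ω → EuclideanSpace ℝ (Fin d))
    (M : Ω → Pattern d) (K : Fin d → ℝ) (μt : EuclideanSpace ℝ (Fin d)) (σt : Fin d → ℝ) :
    Prop where
  prod_eq : ∀ m : Pattern d,
    P⟦{ω | M ω = m} | MeasurableSpace.comap X inferInstance⟧ =ᵐ[P] fun ω =>
      ∏ k, (P⟦{ω' | M ω' k = m k} |
        MeasurableSpace.comap (fun ω' => X ω' k) inferInstance⟧) ω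
  prob_eq : ∀ k : Fin d,
    P⟦{ω | M ω k = true} | MeasurableSpace.comap (fun ω => X ω k) inferInstance⟧ =ᵐ[P]
      fun ω => K k * Real.exp (-(1 / 2) * ((X ω k - μt k) ^ 2 / σt k ^ 2))

/-- The quadratic risk `E[(Y - f(Z))²]`, as an element of `[0, ∞]`. -/
noncomputable def risk (P : Measure Ω) (Y : Ω → ℝ) (Z : Ω → Incomplete d)
    (f : Incomplete d → ℝ) : ℝ≥0∞ :=
  ∫⁻ ω, ENNReal.ofReal ((Y ω - f (Z ω)) ^ 2) ∂P

/-- `f` is a Bayes predictor of `Y` from `Z` for the squared loss: it minimizes the quadratic risk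
among all measurable functions. -/
def IsBayesPredictor (P : Measure Ω) (Y : Ω → ℝ) (Z : Ω → Incomplete d)
    (f : Incomplete d → ℝ) : Prop :=
  Measurable f ∧ ∀ g : Incomplete d → ℝ, Measurable g → risk P Y Z f ≤ risk P Y Z g

end Probability

end MissingData

/-! ### Gaussian integration by parts, on the line and for vectors. -/

namespace MissingData

/-! Y minus the predictor is the noise plus the residual β_mis · (X_mis - `misMean`), so the
conditional expectation is identified once both terms integrate to zero over every event {X̃ ∈ B}.
The noise does so by independence. For the residual, split over the finitely many patterns. On {M =
m}, conditioning on X replaces the indicator by a product of weights; the factors of the observed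
coordinates and the indicator of B depend on x_obs alone. What remains is that, under the Gaussian
law weighted by the profiles of the missing coordinates, the residual is orthogonal to bounded
functions g of x_obs.

Write T = S_{mis|obs}, D = D_mis and c for the Gaussian conditional mean. Multiplying two Gaussian
densities adds precisions, so the weighted law of x_mis given x_obs has mean (T⁻¹ + D⁻¹)⁻¹(T⁻¹c +
D⁻¹μ̃), which is `misMean`. No conditional density is needed: Stein's identity E[⟨a, x - μ⟩ H] =
E[∂_{Sa} H] (`integral_inner_sub_mul_multivariateGaussian`) is applied to H = g · ∏ profiles. The
direction a has (Sa)_obs = 0, so g is not differentiated, and (Sa)_mis = Dq, so the profiles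
contribute -q · (x_mis - μ̃_mis). With q = (Id + DT⁻¹)⁻ᵀ b the two terms combine into b · (x_mis -
`misMean`); see `integral_mul_dotProduct_sub_misMean`.

The statements on Bayes predictors follow from the Pythagorean identity for conditional expectations
in L². -/

theorem hasDerivAt_gaussianPDFReal (m : ℝ) (v : ℝ≥0) (x : ℝ) :
    HasDerivAt (gaussianPDFReal m v) (-((x - m) / v) * gaussianPDFReal m v x) x := by
  have h : HasDerivAt (fun x : ℝ => -(x - m) ^ 2 / (2 * v)) (-(2 * (x - m)) / (2 * v)) x := by
    have := ((((hasDerivAt_id x).sub_const m).pow 2).neg).div_const (2 * (v : ℝ))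
    simpa using this
  have := (h.exp).const_mul ((√(2 * Real.pi * v))⁻¹)
  rw [gaussianPDFReal_def]
  refine this.congr_deriv ?_
  rw [← mul_neg, mul_div_mul_left _ _ two_ne_zero]
  ring

theorem integrable_gaussianReal_iff {m : ℝ} {v : ℝ≥0} (hv : v ≠ 0) {f : ℝ → ℝ} :
    Integrable f (gaussianReal m v) ↔ Integrable (fun x => gaussianPDFReal m v x * f x) := by
  rw [gaussianReal_of_var_ne_zero _ hv, integrable_withDensity_iff_integrable_smul'
    (measurable_gaussianPDF m v) (Filter.Eventually.of_forall fun _ => gaussianPDF_lt_top)]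
  simp [toReal_gaussianPDF]

/-- Gaussian integration by parts on the real line. -/
theorem integral_sub_mul_gaussianReal {m : ℝ} {v : ℝ≥0} (hv : v ≠ 0) {f f' : ℝ → ℝ}
    (hf : ∀ x, HasDerivAt f (f' x) x) (hi : Integrable f (gaussianReal m v))
    (hxi : Integrable (fun x => (x - m) * f x) (gaussianReal m v))
    (hi' : Integrable f' (gaussianReal m v)) :
    ∫ x, (x - m) * f x - v * f' x ∂gaussianReal m v = 0 := by
  have hv' : (v : ℝ) ≠ 0 := by exact_mod_cast hv
  rw [integral_gaussianReal_eq_integral_smul hv]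
  -- With p the density, -v p f has derivative p ((x - m) f - v f'), so the integral over the line
  -- vanishes.
  have hd := fun x => ((hasDerivAt_gaussianPDFReal m v x).mul (hf x)).const_mul (-(v : ℝ))
  have key := integral_eq_zero_of_hasDerivAt_of_integrable hd ?_ ?_
  · rw [← key]
    refine integral_congr_ae (Filter.Eventually.of_forall fun x => ?_)
    simp only [smul_eq_mul]
    field_simp
    ring
  · have := (integrable_gaussianReal_iff hv).1 (hxi.sub (hi'.const_mul v))
    refine this.congr (Filter.Eventually.of_forall fun x => ?_)
    simp only [Pi.sub_apply]
    field_simp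
    ring
  · exact ((integrable_gaussianReal_iff hv).1 hi).const_mul _

variable {ι : Type*} [Fintype ι] [DecidableEq ι]

theorem integrable_id_multivariateGaussian (μ : EuclideanSpace ℝ ι) (S : Matrix ι ι ℝ) :
    Integrable (fun x => x) (multivariateGaussian μ S) := IsGaussian.integrable_id

theorem covariance_inner_multivariateGaussian {μ : EuclideanSpace ℝ ι} {S : Matrix ι ι ℝ}
    (hS : S.PosSemidef) (a b : EuclideanSpace ℝ ι) :
    cov[fun x => inner ℝ a x, fun x => inner ℝ b x; multivariateGaussian μ S] =
      a ⬝ᵥ S *ᵥ b := by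
  rw [← covarianceBilin_multivariateGaussian (μ := μ) hS,
    covarianceBilin_apply_eq_cov IsGaussian.memLp_two_id]

theorem integral_inner_sub_multivariateGaussian (μ : EuclideanSpace ℝ ι) (S : Matrix ι ι ℝ)
    (a : EuclideanSpace ℝ ι) : ∫ x, inner ℝ a (x - μ) ∂multivariateGaussian μ S = 0 := by
  have h := integrable_id_multivariateGaussian μ S
  have h' : Integrable (fun x => x - μ) (multivariateGaussian μ S) := h.sub (integrable_const μ)
  rw [integral_inner h' a, integral_sub h (integrable_const μ)]
  simp

theorem hasGaussianLaw_sub_multivariateGaussian (μ : EuclideanSpace ℝ ι) (S : Matrix ι ι ℝ) :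
    HasGaussianLaw (fun x => x - μ) (multivariateGaussian μ S) := ⟨inferInstance⟩

theorem map_inner_sub_multivariateGaussian {μ : EuclideanSpace ℝ ι} {S : Matrix ι ι ℝ}
    (hS : S.PosSemidef) (a : EuclideanSpace ℝ ι) :
    (multivariateGaussian μ S).map (fun x => inner ℝ a (x - μ)) =
      gaussianReal 0 (a ⬝ᵥ S *ᵥ a).toNNReal := by
  have hG : HasGaussianLaw (fun x => inner ℝ a (x - μ)) (multivariateGaussian μ S) := by
    have := (hasGaussianLaw_sub_multivariateGaussian μ S).map_fun
      (innerSL ℝ a)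
    simpa using this
  rw [hG.map_eq_gaussianReal, integral_inner_sub_multivariateGaussian]
  congr 2
  simp_rw [inner_sub_right]
  rw [variance_sub_const (by fun_prop), ← covariance_self (by fun_prop),
    covariance_inner_multivariateGaussian hS]

/-- The coordinate of a Gaussian vector along `a` is independent of the remainder of its
regression on that coordinate. -/
theorem indepFun_inner_sub_multivariateGaussian {μ : EuclideanSpace ℝ ι} {S : Matrix ι ι ℝ}
    (hS : S.PosSemidef) (a u : EuclideanSpace ℝ ι)
    (hu : (a ⬝ᵥ S *ᵥ a) • u = WithLp.toLp 2 (S *ᵥ a)) :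
    IndepFun (fun x => inner ℝ a (x - μ)) (fun x => x - μ - (inner ℝ a (x - μ) : ℝ) • u)
      (multivariateGaussian μ S) := by
  have hG : HasGaussianLaw (fun x => ((inner ℝ a (x - μ) : ℝ),
      x - μ - (inner ℝ a (x - μ) : ℝ) • u)) (multivariateGaussian μ S) := by
    have := (hasGaussianLaw_sub_multivariateGaussian μ S).map_fun
      ((innerSL ℝ a).prod (ContinuousLinearMap.id ℝ _ - (innerSL ℝ a).smulRight u))
    simpa using this
  -- The pair is jointly Gaussian, so zero covariance of all linear functionals suffices.
  refine hG.indepFun_of_covariance_inner fun c y => ?_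
  have h1 : (fun x : EuclideanSpace ℝ ι => (inner ℝ c (inner ℝ a (x - μ) : ℝ) : ℝ)) =
      fun x => inner ℝ (c • a) x - inner ℝ (c • a) μ := by
    ext x
    simp only [inner_sub_right, inner_smul_left, RCLike.inner_apply, conj_trivial]
    ring
  have h2 : (fun x : EuclideanSpace ℝ ι =>
      (inner ℝ y (x - μ - (inner ℝ a (x - μ) : ℝ) • u) : ℝ)) =
      fun x => inner ℝ (y - (inner ℝ y u : ℝ) • a) x - inner ℝ (y - (inner ℝ y u : ℝ) • a) μ := by
    ext x
    simp only [inner_sub_right, inner_sub_left, inner_smul_left, inner_smul_right, conj_trivial]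
    ring
  rw [h1, h2, covariance_sub_const_left, covariance_sub_const_right,
    covariance_inner_multivariateGaussian hS]
  · have hy : (inner ℝ y u : ℝ) * (a ⬝ᵥ S *ᵥ a) = a ⬝ᵥ S *ᵥ y := by
      rw [mul_comm, ← real_inner_smul_right, hu]
      have : Sᵀ = S := by simpa using hS.isHermitian.eq
      rw [Matrix.dotProduct_mulVec a, ← Matrix.mulVec_transpose, this]
      simp [PiLp.inner_apply, dotProduct]
    simp only [WithLp.ofLp_smul, WithLp.ofLp_sub, Matrix.mulVec_sub, Matrix.mulVec_smul,
      dotProduct_sub, dotProduct_smul, smul_dotProduct, smul_eq_mul]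
    linear_combination (-c) * hy
  all_goals exact (integrable_id_multivariateGaussian μ S).const_inner _

/-- Gaussian integration by parts (Stein's identity) for a Gaussian vector. -/
theorem integral_inner_sub_mul_multivariateGaussian {μ : EuclideanSpace ℝ ι}
    {S : Matrix ι ι ℝ} (hS : S.PosDef) (a : EuclideanSpace ℝ ι)
    {H H' : EuclideanSpace ℝ ι → ℝ} (hm : Measurable H) (hm' : Measurable H')
    (hd : ∀ x, HasLineDerivAt ℝ H (H' x) x (WithLp.toLp 2 (S *ᵥ a)))
    (hi : Integrable H (multivariateGaussian μ S))
    (hxi : Integrable (fun x => inner ℝ a (x - μ) * H x) (multivariateGaussian μ S))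
    (hi' : Integrable H' (multivariateGaussian μ S)) :
    ∫ x, inner ℝ a (x - μ) * H x - H' x ∂multivariateGaussian μ S = 0 := by
  -- For a = 0 the variance v below vanishes and cannot be inverted, but then both terms are zero.
  by_cases ha : a = 0
  · subst ha
    have : ∀ x, H' x = 0 := fun x => by
      have h := hd x
      simp only [WithLp.ofLp_zero, Matrix.mulVec_zero, WithLp.toLp_zero] at h
      exact h.unique (by simpa [HasLineDerivAt] using hasDerivAt_const (0 : ℝ) (H x))
    simp [this]
  set v : ℝ := a ⬝ᵥ S *ᵥ a with hv
  have hvpos : 0 < v := by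
    have := hS.dotProduct_mulVec_pos (x := a.ofLp) (by simpa using ha)
    simpa using this
  set u : EuclideanSpace ℝ ι := v⁻¹ • WithLp.toLp 2 (S *ᵥ a) with hu
  have hvu : v • u = WithLp.toLp 2 (S *ᵥ a) := by rw [hu, smul_inv_smul₀ hvpos.ne']
  set γ := multivariateGaussian μ S
  set L : EuclideanSpace ℝ ι → ℝ := fun x => inner ℝ a (x - μ) with hL
  set R : EuclideanSpace ℝ ι → EuclideanSpace ℝ ι := fun x => x - μ - L x • u with hR
  have hLm : Measurable L := by fun_prop
  have hRm : Measurable R := by fun_prop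
  have hind : IndepFun L R γ := indepFun_inner_sub_multivariateGaussian hS.posSemidef a u hvu
  -- `e` rebuilds x from its coordinate along `a` and the independent remainder; Fubini then leaves
  -- a one-dimensional identity for each fixed remainder.
  let e : ℝ × EuclideanSpace ℝ ι → EuclideanSpace ℝ ι := fun p => μ + p.1 • u + p.2
  have hem : Measurable e := by fun_prop
  have he : ∀ x, e (L x, R x) = x := fun x => by simp [e, hR]
  have hmap : γ.map (fun x => (L x, R x)) =
      (gaussianReal 0 v.toNNReal).prod (γ.map R) := by
    rw [(indepFun_iff_map_prod_eq_prod_map_map hLm.aemeasurable hRm.aemeasurable).1 hind]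
    congr 1
    exact map_inner_sub_multivariateGaussian hS.posSemidef a
  have hLR : Measurable fun x => (L x, R x) := hLm.prodMk hRm
  have : IsProbabilityMeasure (γ.map R) := Measure.isProbabilityMeasure_map hRm.aemeasurable
  have tr : ∀ G : ℝ × EuclideanSpace ℝ ι → ℝ, Measurable G →
      Integrable (fun x => G (L x, R x)) γ →
      Integrable G ((gaussianReal 0 v.toNNReal).prod (γ.map R)) := fun G hG hGi => by
    rw [← hmap, integrable_map_measure hG.aestronglyMeasurable hLR.aemeasurable]
    exact hGi
  have I1 := tr (fun p => H (e p)) (hm.comp hem) (by simpa only [he] using hi)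
  have I2 := tr (fun p => p.1 * H (e p)) (measurable_fst.mul (hm.comp hem))
    (by simpa only [he] using hxi)
  have I3 := tr (fun p => H' (e p)) (hm'.comp hem) (by simpa only [he] using hi')
  have e1 : ∫ x, L x * H x - H' x ∂γ =
      ∫ p, p.1 * H (e p) - H' (e p) ∂((gaussianReal 0 v.toNNReal).prod (γ.map R)) := by
    rw [← hmap, integral_map hLR.aemeasurable]
    · simp only [he]
    · exact ((measurable_fst.mul (hm.comp hem)).sub (hm'.comp hem)).aestronglyMeasurable
  have I23 : Integrable (fun p => p.1 * H (e p) - H' (e p))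
    ((gaussianReal 0 v.toNNReal).prod (γ.map R)) := I2.sub I3
  rw [e1, integral_prod_symm _ I23]
  refine integral_eq_zero_of_ae ?_
  filter_upwards [I1.prod_left_ae, I2.prod_left_ae, I3.prod_left_ae] with r h1 h2 h3
  have hvr : (v.toNNReal : ℝ) = v := Real.coe_toNNReal _ hvpos.le
  -- The factor v⁻¹ appears because u = v⁻¹ S a; it cancels the variance in the one-dimensional
  -- formula.
  have := integral_sub_mul_gaussianReal (m := 0) (v := v.toNNReal)
    (f := fun t => H (e (t, r))) (f' := fun t => v⁻¹ * H' (e (t, r)))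
    (by simpa using hvpos) (fun t => ?_) h1 (by simpa using h2) (h3.const_mul _)
  · simp only [sub_zero, hvr, mul_inv_cancel_left₀ hvpos.ne'] at this
    simpa using this
  · have hl : HasLineDerivAt ℝ H (v⁻¹ * H' (e (t, r))) (e (t, r)) u := by
      have := (hd (e (t, r))).smul v⁻¹
      simpa [hu] using this
    have h := HasDerivAt.comp_sub_const (f := fun s : ℝ => H (e (t, r) + s • u)) t t
      (by simpa [HasLineDerivAt] using hl)
    refine h.congr_of_eventuallyEq (Filter.Eventually.of_forall fun s => ?_)
    have : e (s, r) = e (t, r) + (s - t) • u := by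
      change μ + s • u + r = μ + t • u + r + (s - t) • u
      rw [sub_smul]
      abel
    simp only [this]

end MissingData

/-! ### Block algebra: Schur complements and the direction of integration by parts. -/

namespace MissingData

variable {d : ℕ}

theorem sum_eq_sum_obs_add_sum_mis (m : Pattern d) (f : Fin d → ℝ) :
    ∑ k, f k = ∑ i : Obs m, f i + ∑ j : Mis m, f j := by
  rw [← Fintype.sum_subtype_add_sum_subtype (fun k => m k = false) f]
  congr 1
  exact Fintype.sum_equiv (Equiv.subtypeEquivRight fun k => by simp) _ _ fun _ => rfl

theorem prod_eq_prod_obs_mul_prod_mis (m : Pattern d) (f : Fin d → ℝ) :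
    ∏ k, f k = (∏ i : Obs m, f i) * ∏ j : Mis m, f j := by
  rw [← Fintype.prod_subtype_mul_prod_subtype (fun k => m k = false) f]
  congr 1
  exact Fintype.prod_equiv (Equiv.subtypeEquivRight fun k => by simp) _ _ fun _ => rfl

theorem dotProduct_eq_vecObs_add_vecMis (m : Pattern d) (x y : EuclideanSpace ℝ (Fin d)) :
    x ⬝ᵥ y = vecObs x m ⬝ᵥ vecObs y m + vecMis x m ⬝ᵥ vecMis y m :=
  sum_eq_sum_obs_add_sum_mis m _

theorem inner_eq_vecObs_add_vecMis (m : Pattern d) (x y : EuclideanSpace ℝ (Fin d)) :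
    inner ℝ x y = vecObs x m ⬝ᵥ vecObs y m + vecMis x m ⬝ᵥ vecMis y m := by
  rw [← dotProduct_eq_vecObs_add_vecMis, EuclideanSpace.inner_eq_star_dotProduct,
    dotProduct_comm]
  simp

theorem vecObs_mulVec (S : Matrix (Fin d) (Fin d) ℝ) (m : Pattern d)
    (x : EuclideanSpace ℝ (Fin d)) :
    vecObs (WithLp.toLp 2 (S *ᵥ x)) m =
      blockObs S m *ᵥ vecObs x m + blockObsMis S m *ᵥ vecMis x m := by
  ext i
  exact sum_eq_sum_obs_add_sum_mis m _

theorem vecMis_mulVec (S : Matrix (Fin d) (Fin d) ℝ) (m : Pattern d)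
    (x : EuclideanSpace ℝ (Fin d)) :
    vecMis (WithLp.toLp 2 (S *ᵥ x)) m =
      blockMisObs S m *ᵥ vecObs x m + blockMis S m *ᵥ vecMis x m := by
  ext i
  exact sum_eq_sum_obs_add_sum_mis m _

theorem posDef_blockObs {S : Matrix (Fin d) (Fin d) ℝ} (hS : S.PosDef) (m : Pattern d) :
    (blockObs S m).PosDef := hS.submatrix Subtype.val_injective

theorem posDef_blockMis {S : Matrix (Fin d) (Fin d) ℝ} (hS : S.PosDef) (m : Pattern d) :
    (blockMis S m).PosDef := hS.submatrix Subtype.val_injective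

theorem transpose_blockObsMis {S : Matrix (Fin d) (Fin d) ℝ} (hS : S.IsHermitian)
    (m : Pattern d) : (blockObsMis S m)ᵀ = blockMisObs S m := by
  ext i j
  exact hS.apply i.1 j.1

theorem isUnit_det_of_posDef {n : Type*} [Fintype n] [DecidableEq n] {A : Matrix n n ℝ}
    (hA : A.PosDef) : IsUnit A.det := (Matrix.isUnit_iff_isUnit_det _).1 hA.isUnit

/-- The vector `a` with `a_mis = w` and `(S a)_obs = 0`. -/
noncomputable def obsOrthogonal (S : Matrix (Fin d) (Fin d) ℝ) (m : Pattern d) (w : Mis m → ℝ) :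
    EuclideanSpace ℝ (Fin d) :=
  WithLp.toLp 2 fun k => if h : m k = true then w ⟨k, h⟩
    else -(((blockObs S m)⁻¹ * blockObsMis S m) *ᵥ w) ⟨k, by simpa using h⟩

theorem vecMis_obsOrthogonal (S : Matrix (Fin d) (Fin d) ℝ) (m : Pattern d) (w : Mis m → ℝ) :
    vecMis (obsOrthogonal S m w) m = w := by
  ext ⟨k, hk⟩
  simp [vecMis, obsOrthogonal, hk]

theorem vecObs_obsOrthogonal (S : Matrix (Fin d) (Fin d) ℝ) (m : Pattern d) (w : Mis m → ℝ) :
    vecObs (obsOrthogonal S m w) m = -(((blockObs S m)⁻¹ * blockObsMis S m) *ᵥ w) := by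
  ext ⟨k, hk⟩
  simp [vecObs, obsOrthogonal, hk]

theorem vecObs_mulVec_obsOrthogonal {S : Matrix (Fin d) (Fin d) ℝ} (hS : S.PosDef)
    (m : Pattern d) (w : Mis m → ℝ) :
    vecObs (WithLp.toLp 2 (S *ᵥ obsOrthogonal S m w)) m = 0 := by
  rw [vecObs_mulVec, vecObs_obsOrthogonal, vecMis_obsOrthogonal, Matrix.mulVec_neg,
    Matrix.mulVec_mulVec, ← Matrix.mul_assoc,
    Matrix.mul_nonsing_inv _ (isUnit_det_of_posDef (posDef_blockObs hS m)), Matrix.one_mul,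
    neg_add_cancel]

theorem vecMis_mulVec_obsOrthogonal (S : Matrix (Fin d) (Fin d) ℝ) (m : Pattern d)
    (w : Mis m → ℝ) :
    vecMis (WithLp.toLp 2 (S *ᵥ obsOrthogonal S m w)) m = condCov S m *ᵥ w := by
  rw [vecMis_mulVec, vecObs_obsOrthogonal, vecMis_obsOrthogonal, Matrix.mulVec_neg,
    Matrix.mulVec_mulVec, condCov, Matrix.sub_mulVec, Matrix.mul_assoc]
  abel

/-- The quadratic form of the Schur complement at w is that of S at `obsOrthogonal S m w`, a nonzero
vector when w ≠ 0. -/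
theorem posDef_condCov {S : Matrix (Fin d) (Fin d) ℝ} (hS : S.PosDef) (m : Pattern d) :
    (condCov S m).PosDef := by
  refine Matrix.PosDef.of_dotProduct_mulVec_pos ?_ fun w hw => ?_
  · have h1 : (blockObsMis S m)ᴴ = blockMisObs S m := by
      simpa using transpose_blockObsMis hS.isHermitian m
    have h2 : (blockMisObs S m)ᴴ = blockObsMis S m := by
      rw [← h1, Matrix.conjTranspose_conjTranspose]
    rw [Matrix.IsHermitian, condCov, Matrix.conjTranspose_sub, Matrix.conjTranspose_mul,
      Matrix.conjTranspose_mul, h1, h2, (posDef_blockObs hS m).inv.isHermitian.eq,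
      (posDef_blockMis hS m).isHermitian.eq, Matrix.mul_assoc]
  · have hne : obsOrthogonal S m w ≠ 0 := fun h => hw <| by
      rw [← vecMis_obsOrthogonal S m w, h]
      rfl
    have := hS.dotProduct_mulVec_pos (x := (obsOrthogonal S m w).ofLp) (by simpa using hne)
    have e := dotProduct_eq_vecObs_add_vecMis m (obsOrthogonal S m w)
      (WithLp.toLp 2 (S *ᵥ obsOrthogonal S m w))
    rw [vecObs_mulVec_obsOrthogonal hS, vecMis_mulVec_obsOrthogonal, vecMis_obsOrthogonal,
      dotProduct_zero, zero_add] at e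
    simp only [star_trivial] at this ⊢
    rwa [← e]

/-- By symmetry of S, the observed part -S_obs⁻¹ S_{obs,mis} w transposes to the regression matrix,
so these directions read off the regression residual. -/
theorem inner_obsOrthogonal_sub {S : Matrix (Fin d) (Fin d) ℝ} (hS : S.PosDef)
    (m : Pattern d) (w : Mis m → ℝ) (μ x : EuclideanSpace ℝ (Fin d)) :
    inner ℝ (obsOrthogonal S m w) (x - μ) =
      w ⬝ᵥ (vecMis x m - condMean μ S m (vecObs x m)) := by
  have h : (blockObs S m)⁻¹ᵀ = (blockObs S m)⁻¹ := by
    simpa using (posDef_blockObs hS m).inv.isHermitian.eq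
  have h1 : vecObs (x - μ) m = vecObs x m - vecObs μ m := rfl
  have h2 : vecMis (x - μ) m = vecMis x m - vecMis μ m := rfl
  rw [inner_eq_vecObs_add_vecMis m, vecObs_obsOrthogonal, vecMis_obsOrthogonal, h1, h2, condMean,
    neg_dotProduct, dotProduct_comm, Matrix.dotProduct_mulVec, ← Matrix.mulVec_transpose,
    Matrix.transpose_mul, h, transpose_blockObsMis hS.isHermitian, dotProduct_comm _ w,
    ← sub_sub, dotProduct_sub w _ (_ *ᵥ _)]
  ring

/-- The conditional mean of the missing block given the observed block under Gaussian
self-masking. -/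
noncomputable def misMean (μ : EuclideanSpace ℝ (Fin d)) (S : Matrix (Fin d) (Fin d) ℝ)
    (μt : EuclideanSpace ℝ (Fin d)) (σt : Fin d → ℝ) (m : Pattern d) (xobs : Obs m → ℝ) :
    Mis m → ℝ :=
  (1 + blockMis (maskCov σt) m * (condCov S m)⁻¹)⁻¹ *ᵥ
    (vecMis μt m + (blockMis (maskCov σt) m * (condCov S m)⁻¹) *ᵥ condMean μ S m xobs)

theorem posDef_maskCov {σt : Fin d → ℝ} (hσt : ∀ k, σt k ≠ 0) : (maskCov σt).PosDef :=
  Matrix.PosDef.diagonal fun k => by have := hσt k; positivity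

/-- Factor Id + DT⁻¹ = D(D⁻¹ + T⁻¹): both factors are positive definite. -/
theorem isUnit_one_add_blockMis_maskCov_mul {S : Matrix (Fin d) (Fin d) ℝ} (hS : S.PosDef)
    {σt : Fin d → ℝ} (hσt : ∀ k, σt k ≠ 0) (m : Pattern d) :
    IsUnit (1 + blockMis (maskCov σt) m * (condCov S m)⁻¹) := by
  have hD := posDef_blockMis (posDef_maskCov hσt) m
  have : 1 + blockMis (maskCov σt) m * (condCov S m)⁻¹ =
      blockMis (maskCov σt) m * ((blockMis (maskCov σt) m)⁻¹ + (condCov S m)⁻¹) := by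
    rw [mul_add, Matrix.mul_nonsing_inv _ (isUnit_det_of_posDef hD)]
  rw [this]
  exact hD.isUnit.mul (hD.inv.add (posDef_condCov hS m).inv).isUnit

theorem blockMis_maskCov (σt : Fin d → ℝ) (m : Pattern d) :
    blockMis (maskCov σt) m = Matrix.diagonal fun j : Mis m => σt j ^ 2 := by
  ext i j
  simp [blockMis, maskCov, Matrix.diagonal_apply, Subtype.ext_iff]

/-- The vector `(Id + D_mis S_{mis|obs}⁻¹)⁻ᵀ b`. -/
noncomputable def tiltCoeff (S : Matrix (Fin d) (Fin d) ℝ) (σt : Fin d → ℝ) (m : Pattern d)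
    (b : Mis m → ℝ) : Mis m → ℝ :=
  b ᵥ* (1 + blockMis (maskCov σt) m * (condCov S m)⁻¹)⁻¹

/-- The direction along which integration by parts yields the residual of the missing block. -/
noncomputable def tiltDir (S : Matrix (Fin d) (Fin d) ℝ) (σt : Fin d → ℝ) (m : Pattern d)
    (b : Mis m → ℝ) : EuclideanSpace ℝ (Fin d) :=
  obsOrthogonal S m ((condCov S m)⁻¹ *ᵥ (blockMis (maskCov σt) m *ᵥ tiltCoeff S σt m b))

/-- Multiplying x_mis - `misMean` by Id + DT⁻¹ gives (x_mis - μ̃_mis) + DT⁻¹(x_mis - c). Pairing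
with q = `tiltCoeff` and moving DT⁻¹ across by symmetry yields the two terms of Stein's identity. -/
theorem dotProduct_sub_misMean {S : Matrix (Fin d) (Fin d) ℝ} (hS : S.PosDef)
    (μ μt : EuclideanSpace ℝ (Fin d)) {σt : Fin d → ℝ} (hσt : ∀ k, σt k ≠ 0) (m : Pattern d)
    (b : Mis m → ℝ) (x : EuclideanSpace ℝ (Fin d)) :
    b ⬝ᵥ (vecMis x m - misMean μ S μt σt m (vecObs x m)) =
      inner ℝ (tiltDir S σt m b) (x - μ) +
        tiltCoeff S σt m b ⬝ᵥ (vecMis x m - vecMis μt m) := by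
  rw [tiltDir, inner_obsOrthogonal_sub hS, misMean]
  set T := condCov S m with hT
  set D := blockMis (maskCov σt) m with hD
  set B := 1 + D * T⁻¹ with hB
  set c := condMean μ S m (vecObs x m)
  have hBu : IsUnit B.det := (Matrix.isUnit_iff_isUnit_det _).1
    (isUnit_one_add_blockMis_maskCov_mul hS hσt m)
  have hTt : T⁻¹ᵀ = T⁻¹ := by simpa using (posDef_condCov hS m).inv.isHermitian.eq
  have hDt : Dᵀ = D := by
    simpa using (posDef_blockMis (posDef_maskCov hσt) m).isHermitian.eq
  have e1 : vecMis x m = B⁻¹ *ᵥ (vecMis x m + (D * T⁻¹) *ᵥ vecMis x m) := by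
    have : vecMis x m + (D * T⁻¹) *ᵥ vecMis x m = B *ᵥ vecMis x m := by
      rw [hB, Matrix.add_mulVec, Matrix.one_mulVec]
    rw [this, Matrix.mulVec_mulVec, Matrix.nonsing_inv_mul _ hBu, Matrix.one_mulVec]
  have e2 : ∀ y : Mis m → ℝ, (T⁻¹ *ᵥ (D *ᵥ tiltCoeff S σt m b)) ⬝ᵥ y =
      tiltCoeff S σt m b ⬝ᵥ ((D * T⁻¹) *ᵥ y) := fun y => by
    rw [Matrix.mulVec_mulVec, dotProduct_comm, Matrix.dotProduct_mulVec,
      ← Matrix.mulVec_transpose, Matrix.transpose_mul, hTt, hDt, dotProduct_comm]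
  rw [e2, ← dotProduct_add, tiltCoeff, ← hT, ← hD, ← hB, ← Matrix.dotProduct_mulVec]
  conv_lhs => rw [e1]
  rw [← Matrix.mulVec_sub]
  congr 2
  rw [Matrix.mulVec_sub]
  abel

theorem vecMis_mulVec_tiltDir {S : Matrix (Fin d) (Fin d) ℝ} (hS : S.PosDef) (σt : Fin d → ℝ)
    (m : Pattern d) (b : Mis m → ℝ) (j : Mis m) :
    (S *ᵥ tiltDir S σt m b) j = σt j ^ 2 * tiltCoeff S σt m b j := by
  have h : vecMis (WithLp.toLp 2 (S *ᵥ tiltDir S σt m b)) m j = _ :=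
    congrFun (vecMis_mulVec_obsOrthogonal S m _) j
  rw [Matrix.mulVec_mulVec, Matrix.mul_nonsing_inv _ (isUnit_det_of_posDef (posDef_condCov hS m)),
    Matrix.one_mulVec, blockMis_maskCov, Matrix.mulVec_diagonal] at h
  exact h

theorem mulVec_tiltDir_obs {S : Matrix (Fin d) (Fin d) ℝ} (hS : S.PosDef) (σt : Fin d → ℝ)
    (m : Pattern d) (b : Mis m → ℝ) (i : Obs m) :
    (S *ᵥ tiltDir S σt m b) i = 0 :=
  congrFun (vecObs_mulVec_obsOrthogonal hS m _) i

theorem selfMaskingPredictor_eq (β₀ : ℝ) (β μ : EuclideanSpace ℝ (Fin d))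
    (S : Matrix (Fin d) (Fin d) ℝ) (μt : EuclideanSpace ℝ (Fin d)) (σt : Fin d → ℝ)
    (m : Pattern d) (xobs : Obs m → ℝ) :
    selfMaskingPredictor β₀ β μ S μt σt m xobs =
      β₀ + vecObs β m ⬝ᵥ xobs + vecMis β m ⬝ᵥ misMean μ S μt σt m xobs := rfl

/-! ### Orthogonality of the residual under the weighted Gaussian law. -/

/-- The missing-probability profile of a coordinate, without its factor `K`. -/
noncomputable def maskWeight (μt : EuclideanSpace ℝ (Fin d)) (σt : Fin d → ℝ) (k : Fin d)
    (x : EuclideanSpace ℝ (Fin d)) : ℝ :=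
  Real.exp (-(1 / 2) * ((x k - μt k) ^ 2 / σt k ^ 2))

theorem maskWeight_pos (μt : EuclideanSpace ℝ (Fin d)) (σt : Fin d → ℝ) (k : Fin d)
    (x : EuclideanSpace ℝ (Fin d)) : 0 < maskWeight μt σt k x := Real.exp_pos _

theorem maskWeight_le_one (μt : EuclideanSpace ℝ (Fin d)) (σt : Fin d → ℝ) (k : Fin d)
    (x : EuclideanSpace ℝ (Fin d)) : maskWeight μt σt k x ≤ 1 := by
  refine Real.exp_le_one_iff.2 ?_
  have : 0 ≤ (x k - μt k) ^ 2 / σt k ^ 2 := by positivity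
  linarith

@[fun_prop]
theorem measurable_maskWeight (μt : EuclideanSpace ℝ (Fin d)) (σt : Fin d → ℝ) (k : Fin d) :
    Measurable (maskWeight μt σt k) := by
  unfold maskWeight
  fun_prop

theorem hasDerivAt_maskWeight (μt : EuclideanSpace ℝ (Fin d)) (σt : Fin d → ℝ) (k : Fin d)
    (x v : EuclideanSpace ℝ (Fin d)) :
    HasDerivAt (fun t : ℝ => maskWeight μt σt k (x + t • v))
      (-((x k - μt k) * v k / σt k ^ 2) * maskWeight μt σt k x) 0 := by
  have h1 : HasDerivAt (fun t : ℝ => x k + t * v k - μt k) (v k) 0 := by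
    simpa using (((hasDerivAt_id (0 : ℝ)).mul_const (v k)).const_add (x k)).sub_const (μt k)
  have h2 := (((h1.pow 2).div_const (σt k ^ 2)).const_mul (-(1 / 2 : ℝ))).exp
  refine (h2.congr_deriv ?_)
  simp [maskWeight]
  ring

theorem memLp_dotProduct_vecMis_sub (μ : EuclideanSpace ℝ (Fin d)) (S : Matrix (Fin d) (Fin d) ℝ)
    (m : Pattern d) (c : EuclideanSpace ℝ (Fin d)) (q : Mis m → ℝ) :
    MemLp (fun x => q ⬝ᵥ (vecMis x m - vecMis c m)) 2 (multivariateGaussian μ S) := by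
  have hid : MemLp (fun x => x) 2 (multivariateGaussian μ S) := IsGaussian.memLp_two_id
  refine memLp_finsetSum _ fun j _ => MemLp.const_mul (MemLp.sub ?_ (memLp_const _)) _
  have := hid.const_inner (𝕜 := ℝ) (EuclideanSpace.single j.1 (1 : ℝ))
  simpa [EuclideanSpace.inner_single_left, vecMis] using this

theorem memLp_inner_sub (μ : EuclideanSpace ℝ (Fin d)) (S : Matrix (Fin d) (Fin d) ℝ)
    (a : EuclideanSpace ℝ (Fin d)) :
    MemLp (fun x => inner ℝ a (x - μ)) 2 (multivariateGaussian μ S) := by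
  have hid : MemLp (fun x => x) 2 (multivariateGaussian μ S) := IsGaussian.memLp_two_id
  exact (hid.sub (memLp_const μ)).const_inner a

theorem memLp_dotProduct_sub_misMean {S : Matrix (Fin d) (Fin d) ℝ} (hS : S.PosDef)
    (μ μt : EuclideanSpace ℝ (Fin d)) {σt : Fin d → ℝ} (hσt : ∀ k, σt k ≠ 0) (m : Pattern d)
    (b : Mis m → ℝ) :
    MemLp (fun x => b ⬝ᵥ (vecMis x m - misMean μ S μt σt m (vecObs x m))) 2
      (multivariateGaussian μ S) := by
  simp_rw [dotProduct_sub_misMean hS μ μt hσt m b]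
  exact (memLp_inner_sub μ S _).add (memLp_dotProduct_vecMis_sub μ S m μt _)

/-- Under the Gaussian law tilted by the missingness profiles, the residual of the missing block
is orthogonal to every bounded function of the observed block. -/
theorem integral_mul_dotProduct_sub_misMean {S : Matrix (Fin d) (Fin d) ℝ} (hS : S.PosDef)
    (μ μt : EuclideanSpace ℝ (Fin d)) {σt : Fin d → ℝ} (hσt : ∀ k, σt k ≠ 0) (m : Pattern d)
    (b : Mis m → ℝ) {g : EuclideanSpace ℝ (Fin d) → ℝ} (hg : Measurable g) {C : ℝ}
    (hgC : ∀ x, |g x| ≤ C) (hgo : ∀ x y, vecObs x m = vecObs y m → g x = g y) :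
    ∫ x, (g x * ∏ j : Mis m, maskWeight μt σt j x) *
      (b ⬝ᵥ (vecMis x m - misMean μ S μt σt m (vecObs x m))) ∂multivariateGaussian μ S = 0 := by
  set q := tiltCoeff S σt m b
  set a := tiltDir S σt m b
  set H : EuclideanSpace ℝ (Fin d) → ℝ := fun x => g x * ∏ j : Mis m, maskWeight μt σt j x
    with hH
  have hHm : Measurable H := by fun_prop
  have hHC : ∀ x, ‖H x‖ ≤ C := fun x => by
    rw [hH, norm_mul]
    have h1 : ‖∏ j : Mis m, maskWeight μt σt j x‖ ≤ 1 := by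
      rw [norm_prod]
      refine Finset.prod_le_one (fun _ _ => norm_nonneg _) fun j _ => ?_
      rw [Real.norm_of_nonneg (maskWeight_pos _ _ _ _).le]
      exact maskWeight_le_one _ _ _ _
    calc ‖g x‖ * _ ≤ ‖g x‖ * 1 := by gcongr
      _ ≤ C := by simpa using hgC x
  -- The derivative of `H` along S a: only the profiles vary, with logarithmic derivative -q ·
  -- (x_mis - μ̃_mis).
  set H' : EuclideanSpace ℝ (Fin d) → ℝ := fun x => (-(q ⬝ᵥ (vecMis x m - vecMis μt m))) * H x
    with hH'
  have hb : ∀ {f : EuclideanSpace ℝ (Fin d) → ℝ}, Integrable f (multivariateGaussian μ S) →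
      Integrable (fun x => f x * H x) (multivariateGaussian μ S) := fun hf =>
    hf.mul_bdd (c := C) hHm.aestronglyMeasurable (Filter.Eventually.of_forall hHC)
  have hqi := (memLp_dotProduct_vecMis_sub μ S m μt q).integrable one_le_two
  have key := integral_inner_sub_mul_multivariateGaussian (μ := μ) hS a (H := H) (H' := H') hHm
    ?_ ?_ ?_ ?_ ?_
  · rw [← key]
    refine integral_congr_ae (Filter.Eventually.of_forall fun x => ?_)
    simp only [dotProduct_sub_misMean hS μ μt hσt m b, hH']
    ring
  · refine Measurable.mul (Measurable.neg ?_) hHm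
    simp only [dotProduct, vecMis, Pi.sub_apply]
    fun_prop
  · intro x
    -- S a has no observed component, so no smoothness of `g` is required.
    have hgx : ∀ t : ℝ, g (x + t • WithLp.toLp 2 (S *ᵥ a)) = g x := fun t => hgo _ _ <| by
      ext i
      simp [vecObs, a, mulVec_tiltDir_obs hS σt m b i]
    have hp := HasDerivAt.fun_finsetProd (u := (Finset.univ : Finset (Mis m)))
      fun j _ => hasDerivAt_maskWeight μt σt j x (WithLp.toLp 2 (S *ᵥ a))
    have := hp.const_mul (g x)
    simp only [HasLineDerivAt, hH, hgx]
    refine this.congr_deriv ?_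
    simp only [hH', hH, zero_smul, add_zero, smul_eq_mul]
    -- Since (S a)_j = σ̃_j² q_j, the variance of each profile cancels.
    have e : ∀ j : Mis m, (∏ i ∈ Finset.univ.erase j, maskWeight μt σt i x) *
        (-((x j - μt j) * (S *ᵥ a) j / σt j ^ 2) * maskWeight μt σt j x) =
        (-(q j * (x j - μt j))) * ∏ i : Mis m, maskWeight μt σt i x := fun j => by
      rw [← Finset.mul_prod_erase _ _ (Finset.mem_univ j), vecMis_mulVec_tiltDir hS]
      have := hσt j
      field_simp
      simp only [q]
      ring
    rw [Finset.sum_congr rfl fun j _ => e j, ← Finset.sum_mul, Finset.sum_neg_distrib]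
    simp only [dotProduct, vecMis, Pi.sub_apply]
    ring
  · exact (integrable_const C).mono' hHm.aestronglyMeasurable (Filter.Eventually.of_forall hHC)
  · exact hb ((memLp_inner_sub μ S a).integrable one_le_two)
  · exact hb hqi.neg

end MissingData

namespace MissingData

/-! ### Quadratic risk and conditional expectation. -/

section Bayes

variable {Ω : Type*} [MeasurableSpace Ω] {d : ℕ} {P : Measure Ω}

theorem risk_eq_ofReal_integral {Y : Ω → ℝ} {Z : Ω → Incomplete d} {f : Incomplete d → ℝ}
    (h : MemLp (fun ω => Y ω - f (Z ω)) 2 P) :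
    risk P Y Z f = ENNReal.ofReal (∫ ω, (Y ω - f (Z ω)) ^ 2 ∂P) := by
  rw [risk, ofReal_integral_eq_lintegral_ofReal h.integrable_sq
    (Filter.Eventually.of_forall fun _ => sq_nonneg _)]

theorem memLp_sub_of_risk_ne_top {Y : Ω → ℝ} {Z : Ω → Incomplete d} {f : Incomplete d → ℝ}
    (hY : AEStronglyMeasurable Y P) (hZ : Measurable Z) (hf : Measurable f)
    (h : risk P Y Z f ≠ ∞) : MemLp (fun ω => Y ω - f (Z ω)) 2 P := by
  have hm : AEStronglyMeasurable (fun ω => Y ω - f (Z ω)) P :=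
    hY.sub (hf.comp hZ).aestronglyMeasurable
  rw [memLp_two_iff_integrable_sq hm]
  refine ⟨hm.pow 2, ?_⟩
  rw [hasFiniteIntegral_iff_ofReal (Filter.Eventually.of_forall fun _ => sq_nonneg _)]
  exact lt_top_iff_ne_top.2 h

variable [IsProbabilityMeasure P]

/-- The excess quadratic risk over the conditional expectation. -/
theorem integral_sq_sub_eq_add {Y : Ω → ℝ} {Z : Ω → Incomplete d} (hY : MemLp Y 2 P)
    (hZ : Measurable Z) {F : Incomplete d → ℝ}
    (hFY : P[Y | MeasurableSpace.comap Z inferInstance] =ᵐ[P] fun ω => F (Z ω))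
    (hF : Measurable F) {g : Incomplete d → ℝ} (hg : Measurable g)
    (hFL : MemLp (fun ω => F (Z ω)) 2 P) (hgL : MemLp (fun ω => g (Z ω)) 2 P) :
    ∫ ω, (Y ω - g (Z ω)) ^ 2 ∂P =
      ∫ ω, (Y ω - F (Z ω)) ^ 2 ∂P + ∫ ω, (F (Z ω) - g (Z ω)) ^ 2 ∂P := by
  have hG : MemLp (fun ω => F (Z ω) - g (Z ω)) 2 P := hFL.sub hgL
  have hGm : StronglyMeasurable[MeasurableSpace.comap Z inferInstance]
      (fun ω => F (Z ω) - g (Z ω)) :=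
    ((hF.sub hg).comp (comap_measurable Z)).stronglyMeasurable
  have hYG : Integrable (fun ω => Y ω * (F (Z ω) - g (Z ω))) P := hY.integrable_mul hG
  have hFG : Integrable (fun ω => F (Z ω) * (F (Z ω) - g (Z ω))) P := hFL.integrable_mul hG
  -- F(Z) - g(Z) is measurable for Z, hence can be pulled out of the conditional expectation; this
  -- kills the cross term.
  have hcross : ∫ ω, Y ω * (F (Z ω) - g (Z ω)) ∂P =
      ∫ ω, F (Z ω) * (F (Z ω) - g (Z ω)) ∂P := by
    rw [← integral_condExp hZ.comap_le]
    refine integral_congr_ae ?_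
    filter_upwards [condExp_mul_of_stronglyMeasurable_right hGm hYG
      (hY.integrable one_le_two), hFY] with ω h1 h2
    refine h1.trans ?_
    rw [Pi.mul_apply, h2]
  have hYF : Integrable (fun ω => (Y ω - F (Z ω)) ^ 2) P := (hY.sub hFL).integrable_sq
  have hsum : Integrable (fun ω => (Y ω - F (Z ω)) ^ 2 + (F (Z ω) - g (Z ω)) ^ 2) P :=
    hYF.add hG.integrable_sq
  have hdiff : Integrable (fun ω => 2 * (Y ω * (F (Z ω) - g (Z ω)) -
      F (Z ω) * (F (Z ω) - g (Z ω)))) P := (hYG.sub hFG).const_mul 2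
  calc ∫ ω, (Y ω - g (Z ω)) ^ 2 ∂P
      = ∫ ω, (((Y ω - F (Z ω)) ^ 2 + (F (Z ω) - g (Z ω)) ^ 2) +
        2 * (Y ω * (F (Z ω) - g (Z ω)) - F (Z ω) * (F (Z ω) - g (Z ω)))) ∂P := by
        refine integral_congr_ae (Filter.Eventually.of_forall fun ω => ?_)
        simp only
        ring
    _ = _ := by
        rw [integral_add hsum hdiff, integral_const_mul, integral_sub hYG hFG, hcross,
          integral_add hYF hG.integrable_sq]
        ring

/-- A version of the conditional expectation is a Bayes predictor, and Bayes predictors are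
almost surely unique. -/
theorem isBayesPredictor_and_unique_of_condExp {Y : Ω → ℝ} {Z : Ω → Incomplete d}
    (hY : MemLp Y 2 P) (hZ : Measurable Z) {F : Incomplete d → ℝ} (hF : Measurable F)
    (hFY : P[Y | MeasurableSpace.comap Z inferInstance] =ᵐ[P] fun ω => F (Z ω)) :
    IsBayesPredictor P Y Z F ∧
      ∀ f, IsBayesPredictor P Y Z f → (fun ω => f (Z ω)) =ᵐ[P] fun ω => F (Z ω) := by
  have hFL : MemLp (fun ω => F (Z ω)) 2 P := (hY.condExp one_le_two).ae_eq hFY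
  have hYF : MemLp (fun ω => Y ω - F (Z ω)) 2 P := hY.sub hFL
  -- Competitors are not assumed square-integrable: finite risk forces it through g(Z) = Y - (Y -
  -- g(Z)), and infinite risk makes the comparison trivial.
  have hgL : ∀ g, Measurable g → risk P Y Z g ≠ ∞ → MemLp (fun ω => g (Z ω)) 2 P :=
    fun g hg h => by
      refine (hY.sub (memLp_sub_of_risk_ne_top hY.aestronglyMeasurable hZ hg h)).ae_eq
        (Filter.Eventually.of_forall fun ω => ?_)
      simp
  refine ⟨⟨hF, fun g hg => ?_⟩, fun f hf => ?_⟩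
  · by_cases h : risk P Y Z g = ∞
    · simp [h]
    have hgL' := hgL g hg h
    rw [risk_eq_ofReal_integral hYF, risk_eq_ofReal_integral (hY.sub hgL')]
    refine ENNReal.ofReal_le_ofReal ?_
    rw [integral_sq_sub_eq_add hY hZ hFY hF hg hFL hgL']
    exact le_add_of_nonneg_right (integral_nonneg fun _ => sq_nonneg _)
  · have hle := hf.2 F hF
    have hne : risk P Y Z f ≠ ∞ := ne_top_of_le_ne_top
      (by rw [risk_eq_ofReal_integral hYF]; exact ENNReal.ofReal_ne_top) hle
    have hfL := hgL f hf.1 hne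
    rw [risk_eq_ofReal_integral hYF, risk_eq_ofReal_integral (hY.sub hfL),
      ENNReal.ofReal_le_ofReal_iff (integral_nonneg fun _ => sq_nonneg _),
      integral_sq_sub_eq_add hY hZ hFY hF hf.1 hFL hfL] at hle
    have h0 : ∫ ω, (F (Z ω) - f (Z ω)) ^ 2 ∂P = 0 :=
      le_antisymm (by linarith) (integral_nonneg fun _ => sq_nonneg _)
    have h1 := (integral_eq_zero_iff_of_nonneg (fun _ => sq_nonneg _)
      (hFL.sub hfL).integrable_sq).1 h0
    filter_upwards [h1] with ω hω
    have : F (Z ω) - f (Z ω) = 0 := by simpa using hω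
    linarith

end Bayes

/-! ### Measurability of masking and of the predictor; factorization of the pattern weights. -/

section Masking

variable {d : ℕ}

theorem measurable_mask : Measurable fun p : EuclideanSpace ℝ (Fin d) × Pattern d =>
    mask p.2 p.1 := by
  refine measurable_from_prod_countable_left fun m => measurable_pi_iff.2 fun k => ?_
  by_cases h : m k = true
  · simp [mask, h]
  · simp only [mask, h]
    exact measurable_inl.comp (by fun_prop)

/-- The missingness pattern of an incomplete vector. -/
def patternOf (z : Incomplete d) : Pattern d := fun k => (z k).isRight

/-- The entries of an incomplete vector, missing ones being replaced by `0`. -/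
def fillZero (z : Incomplete d) : EuclideanSpace ℝ (Fin d) :=
  WithLp.toLp 2 fun k => (z k).elim id fun _ => 0

theorem patternOf_mask (m : Pattern d) (x : EuclideanSpace ℝ (Fin d)) :
    patternOf (mask m x) = m := by
  ext k
  cases h : m k <;> simp [patternOf, mask, h]

theorem vecObs_fillZero_mask (m : Pattern d) (x : EuclideanSpace ℝ (Fin d)) :
    vecObs (fillZero (mask m x)) m = vecObs x m := by
  ext ⟨k, hk⟩
  simp [vecObs, fillZero, mask, hk]

theorem mask_congr {m : Pattern d} {x y : EuclideanSpace ℝ (Fin d)}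
    (h : vecObs x m = vecObs y m) : mask m x = mask m y := by
  ext1 k
  cases hk : m k
  · have : x k = y k := congrFun h ⟨k, hk⟩
    simp [mask, hk, this]
  · simp [mask, hk]

theorem measurable_patternOf : Measurable (patternOf : Incomplete d → Pattern d) :=
  measurable_pi_iff.2 fun k =>
    (measurable_fun_sum (f := fun s : ℝ ⊕ Unit => s.isRight)
      (measurable_const (a := false)) (measurable_const (a := true))).comp
      (measurable_pi_apply k)

theorem measurable_fillZero :
    Measurable (fillZero : Incomplete d → EuclideanSpace ℝ (Fin d)) := by
  refine (WithLp.measurable_toLp 2 _).comp (measurable_pi_iff.2 fun k => ?_)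
  exact (measurable_fun_sum (f := fun s : ℝ ⊕ Unit => s.elim id fun _ => (0 : ℝ))
    measurable_id (by simp)).comp (measurable_pi_apply k)

theorem measurable_dotProduct {n : Type*} [Fintype n] (c : n → ℝ) :
    Measurable fun x : n → ℝ => c ⬝ᵥ x :=
  Finset.measurable_sum _ fun j _ => (measurable_pi_apply j).const_mul _

theorem measurable_mulVec {n l : Type*} [Fintype n] (A : Matrix l n ℝ) :
    Measurable fun x : n → ℝ => A *ᵥ x :=
  measurable_pi_iff.2 fun _ => measurable_dotProduct _

theorem measurable_misMean (μ : EuclideanSpace ℝ (Fin d)) (S : Matrix (Fin d) (Fin d) ℝ)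
    (μt : EuclideanSpace ℝ (Fin d)) (σt : Fin d → ℝ) (m : Pattern d) :
    Measurable (misMean μ S μt σt m) := by
  have h : Measurable (condMean μ S m) :=
    ((measurable_mulVec _).comp (measurable_id.sub_const _)).const_add _
  exact (measurable_mulVec _).comp (((measurable_mulVec _).comp h).const_add _)

theorem measurable_selfMaskingPredictor (β₀ : ℝ) (β μ : EuclideanSpace ℝ (Fin d))
    (S : Matrix (Fin d) (Fin d) ℝ) (μt : EuclideanSpace ℝ (Fin d)) (σt : Fin d → ℝ)
    (m : Pattern d) : Measurable (selfMaskingPredictor β₀ β μ S μt σt m) := by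
  exact (measurable_const.add (measurable_dotProduct _)).add
    ((measurable_dotProduct _).comp (measurable_misMean μ S μt σt m))

/-- The predictor as a function of the incomplete vector. -/
noncomputable def incompletePredictor (β₀ : ℝ) (β μ : EuclideanSpace ℝ (Fin d))
    (S : Matrix (Fin d) (Fin d) ℝ) (μt : EuclideanSpace ℝ (Fin d)) (σt : Fin d → ℝ)
    (z : Incomplete d) : ℝ :=
  selfMaskingPredictor β₀ β μ S μt σt (patternOf z) (vecObs (fillZero z) (patternOf z))

theorem incompletePredictor_mask (β₀ : ℝ) (β μ : EuclideanSpace ℝ (Fin d))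
    (S : Matrix (Fin d) (Fin d) ℝ) (μt : EuclideanSpace ℝ (Fin d)) (σt : Fin d → ℝ)
    (m : Pattern d) (x : EuclideanSpace ℝ (Fin d)) :
    incompletePredictor β₀ β μ S μt σt (mask m x) =
      selfMaskingPredictor β₀ β μ S μt σt m (vecObs x m) := by
  rw [incompletePredictor, patternOf_mask, vecObs_fillZero_mask]

theorem measurable_vecObs (m : Pattern d) :
    Measurable fun x : EuclideanSpace ℝ (Fin d) => vecObs x m :=
  measurable_pi_iff.2 fun k => by unfold vecObs; fun_prop

theorem measurable_vecMis (m : Pattern d) :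
    Measurable fun x : EuclideanSpace ℝ (Fin d) => vecMis x m :=
  measurable_pi_iff.2 fun k => by unfold vecMis; fun_prop

theorem measurable_incompletePredictor (β₀ : ℝ) (β μ : EuclideanSpace ℝ (Fin d))
    (S : Matrix (Fin d) (Fin d) ℝ) (μt : EuclideanSpace ℝ (Fin d)) (σt : Fin d → ℝ) :
    Measurable (incompletePredictor β₀ β μ S μt σt) := by
  have h : Measurable fun p : EuclideanSpace ℝ (Fin d) × Pattern d =>
      selfMaskingPredictor β₀ β μ S μt σt p.2 (vecObs p.1 p.2) :=
    measurable_from_prod_countable_left fun m =>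
      (measurable_selfMaskingPredictor β₀ β μ S μt σt m).comp (measurable_vecObs m)
  exact h.comp (measurable_fillZero.prodMk measurable_patternOf)

/-- The probability of the pattern `m` given the data under Gaussian self-masking. -/
noncomputable def patternWeight (K : Fin d → ℝ) (μt : EuclideanSpace ℝ (Fin d))
    (σt : Fin d → ℝ) (m : Pattern d) (x : EuclideanSpace ℝ (Fin d)) : ℝ :=
  ∏ k, if m k = true then K k * maskWeight μt σt k x else 1 - K k * maskWeight μt σt k x

/-- Isolates the missing profiles, which drive the integration by parts, from a factor that depends
only on x_obs and can be absorbed into the test function. -/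
theorem patternWeight_eq (K : Fin d → ℝ) (μt : EuclideanSpace ℝ (Fin d))
    (σt : Fin d → ℝ) (m : Pattern d) (x : EuclideanSpace ℝ (Fin d)) :
    patternWeight K μt σt m x =
      ((∏ i : Obs m, (1 - K i * maskWeight μt σt i x)) * ∏ j : Mis m, K j) *
        ∏ j : Mis m, maskWeight μt σt j x := by
  rw [patternWeight, prod_eq_prod_obs_mul_prod_mis m, mul_assoc, ← Finset.prod_mul_distrib]
  congr 1
  · exact Finset.prod_congr rfl fun i _ => by simp [i.2]
  · exact Finset.prod_congr rfl fun j _ => by simp [j.2]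

end Masking

/-! ### From the self-masking assumption to the centred residual. -/

section SelfMasking

variable {Ω : Type*} [MeasurableSpace Ω] {d : ℕ} {P : Measure Ω} [IsProbabilityMeasure P]
  {X : Ω → EuclideanSpace ℝ (Fin d)} {M : Ω → Pattern d} {K : Fin d → ℝ}
  {μt : EuclideanSpace ℝ (Fin d)} {σt : Fin d → ℝ}

theorem IsGaussianSelfMasking.condExp_pattern (h : IsGaussianSelfMasking P X M K μt σt)
    (hX : Measurable X) (hM : Measurable M) (m : Pattern d) :
    P⟦{ω | M ω = m} | MeasurableSpace.comap X inferInstance⟧ =ᵐ[P] fun ω =>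
      patternWeight K μt σt m (X ω) := by
  have hk : ∀ k, P⟦{ω | M ω k = m k} |
      MeasurableSpace.comap (fun ω => X ω k) inferInstance⟧ =ᵐ[P] fun ω =>
      if m k = true then K k * maskWeight μt σt k (X ω)
      else 1 - K k * maskWeight μt σt k (X ω) := fun k => by
    have hXk : Measurable fun ω => X ω k := by fun_prop
    have hMk : MeasurableSet {ω | M ω k = true} :=
      ((measurable_pi_apply k).comp hM) (MeasurableSet.singleton true)
    cases hmk : m k
    -- The assumption gives only the probability of being missing; an observed coordinate is handled
    -- by complement.
    · have e : ({ω | M ω k = false}.indicator fun _ => (1 : ℝ)) =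
          (fun _ => 1) - {ω | M ω k = true}.indicator fun _ => (1 : ℝ) := by
        ext ω
        cases hω : M ω k <;> simp [hω]
      rw [e]
      filter_upwards [condExp_sub (integrable_const (1 : ℝ))
        ((integrable_const (1 : ℝ)).indicator hMk)
        (MeasurableSpace.comap (fun ω => X ω k) inferInstance), h.prob_eq k] with ω h1 h2
      rw [h1, Pi.sub_apply, h2, condExp_const hXk.comap_le]
      simp [maskWeight]
    · filter_upwards [h.prob_eq k] with ω h1
      rw [h1]
      simp [maskWeight]
  filter_upwards [h.prod_eq m, Filter.eventually_all.2 hk] with ω h1 h2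
  rw [h1, patternWeight]
  exact Finset.prod_congr rfl fun k _ => h2 k

/-- Tower property: f(X) is pulled out given X, the indicator becomes its conditional probability,
and the integral is transported to the law of X. -/
theorem IsGaussianSelfMasking.integral_indicator (h : IsGaussianSelfMasking P X M K μt σt)
    (hX : Measurable X) (hM : Measurable M) {γ : Measure (EuclideanSpace ℝ (Fin d))}
    (hXγ : HasLaw X γ P) (m : Pattern d) {f : EuclideanSpace ℝ (Fin d) → ℝ} (hf : Measurable f)
    (hfi : Integrable f γ) :
    ∫ ω, {ω | M ω = m}.indicator (fun ω => f (X ω)) ω ∂P =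
      ∫ x, patternWeight K μt σt m x * f x ∂γ := by
  have hMm : MeasurableSet {ω | M ω = m} := hM (MeasurableSet.singleton m)
  have hfX : Integrable (fun ω => f (X ω)) P := by
    rw [← hXγ.map_eq] at hfi
    exact hfi.comp_measurable hX
  have hfm : StronglyMeasurable[MeasurableSpace.comap X inferInstance] fun ω => f (X ω) :=
    (hf.comp (comap_measurable X)).stronglyMeasurable
  have e : {ω | M ω = m}.indicator (fun ω => f (X ω)) =
      ({ω | M ω = m}.indicator fun _ => (1 : ℝ)) * fun ω => f (X ω) := by
    ext ω
    by_cases hω : M ω = m <;> simp [hω]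
  have hei : Integrable (({ω | M ω = m}.indicator fun _ => (1 : ℝ)) * fun ω => f (X ω)) P := by
    rw [← e]
    exact hfX.indicator hMm
  have hwm : Measurable (patternWeight K μt σt m) := by
    unfold patternWeight
    refine Finset.measurable_prod _ fun k _ => ?_
    split_ifs <;> fun_prop
  have hwf : Measurable fun x => patternWeight K μt σt m x * f x := hwm.mul hf
  rw [e, ← integral_condExp hX.comap_le, ← hXγ.map_eq,
    integral_map hX.aemeasurable hwf.aestronglyMeasurable]
  refine integral_congr_ae ?_
  filter_upwards [condExp_mul_of_stronglyMeasurable_right hfm hei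
    ((integrable_const (1 : ℝ)).indicator hMm), h.condExp_pattern hX hM m] with ω h1 h2
  rw [h1, Pi.mul_apply, h2]

/-- The residual of the missing block is centred on every event of the incomplete vector. -/
theorem IsGaussianSelfMasking.setIntegral_residual (h : IsGaussianSelfMasking P X M K μt σt)
    (hX : Measurable X) (hM : Measurable M) {μ : EuclideanSpace ℝ (Fin d)}
    {S : Matrix (Fin d) (Fin d) ℝ} (hS : S.PosDef)
    (hXγ : HasLaw X (multivariateGaussian μ S) P) (hK : ∀ k, 0 < K k ∧ K k < 1)
    (hσt : ∀ k, σt k ≠ 0) (β : EuclideanSpace ℝ (Fin d)) {B : Set (Incomplete d)}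
    (hB : MeasurableSet B) :
    MemLp (fun ω => vecMis β (M ω) ⬝ᵥ (vecMis (X ω) (M ω) -
      misMean μ S μt σt (M ω) (vecObs (X ω) (M ω)))) 2 P ∧
    ∫ ω in (fun ω => mask (M ω) (X ω)) ⁻¹' B, vecMis β (M ω) ⬝ᵥ (vecMis (X ω) (M ω) -
      misMean μ S μt σt (M ω) (vecObs (X ω) (M ω))) ∂P = 0 := by
  set γ := multivariateGaussian μ S
  let r : Pattern d → EuclideanSpace ℝ (Fin d) → ℝ := fun m x =>
    vecMis β m ⬝ᵥ (vecMis x m - misMean μ S μt σt m (vecObs x m))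
  have hrm : ∀ m, Measurable (r m) := fun m => by
    have h1 := (measurable_misMean μ S μt σt m).comp (measurable_vecObs m)
    have h2 := measurable_vecMis m
    have h3 := h2.sub h1
    exact (measurable_dotProduct _).comp h3
  have hrL : ∀ m, MemLp (r m) 2 γ := fun m => memLp_dotProduct_sub_misMean hS μ μt hσt m _
  have hMm : ∀ m, MeasurableSet {ω | M ω = m} := fun m => hM (MeasurableSet.singleton m)
  have hsplit : ∀ f : Pattern d → EuclideanSpace ℝ (Fin d) → ℝ, (fun ω => f (M ω) (X ω)) =
      fun ω => ∑ m, {ω | M ω = m}.indicator (fun ω => f m (X ω)) ω := fun f => by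
    ext ω
    simp [Set.indicator_apply]
  have hLX : ∀ m, MemLp (fun ω => r m (X ω)) 2 P := fun m => by
    have := hrL m
    rw [← hXγ.map_eq] at this
    exact this.comp_measurePreserving ⟨hX, rfl⟩
  constructor
  · change MemLp (fun ω => r (M ω) (X ω)) 2 P
    rw [hsplit]
    exact memLp_finsetSum _ fun m _ => (hLX m).indicator (hMm m)
  · have hZ : Measurable fun ω => mask (M ω) (X ω) := measurable_mask.comp (hX.prodMk hM)
    rw [← MeasureTheory.integral_indicator (hZ hB)]
    let b : Pattern d → EuclideanSpace ℝ (Fin d) → ℝ := fun m x =>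
      (mask m ⁻¹' B).indicator (fun _ => 1) x
    have hmm : ∀ m, Measurable (mask m : EuclideanSpace ℝ (Fin d) → _) := fun m =>
      measurable_mask.comp (measurable_id.prodMk measurable_const)
    have hbm : ∀ m, Measurable (b m) := fun m =>
      measurable_const.indicator (hmm m hB)
    have hb0 : ∀ m x, 0 ≤ b m x ∧ b m x ≤ 1 := fun m x => by
      by_cases hx : mask m x ∈ B <;> simp [b, hx]
    have e : ((fun ω => mask (M ω) (X ω)) ⁻¹' B).indicator (fun ω => r (M ω) (X ω)) =
        fun ω => b (M ω) (X ω) * r (M ω) (X ω) := by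
      ext ω
      by_cases hω : mask (M ω) (X ω) ∈ B <;> simp [b, hω]
    change ∫ ω, ((fun ω => mask (M ω) (X ω)) ⁻¹' B).indicator
      (fun ω => r (M ω) (X ω)) ω ∂P = 0
    have hbr : ∀ m, Integrable (fun x => b m x * r m x) γ := fun m =>
      ((hrL m).integrable one_le_two).bdd_mul (c := 1) (hbm m).aestronglyMeasurable
        (Filter.Eventually.of_forall fun x => by
          rw [Real.norm_of_nonneg (hb0 m x).1]; exact (hb0 m x).2)
    have hbrX : ∀ m, Integrable (fun ω => b m (X ω) * r m (X ω)) P := fun m => by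
      have := hbr m
      rw [← hXγ.map_eq] at this
      exact this.comp_measurable hX
    rw [e, hsplit fun m x => b m x * r m x,
      integral_finsetSum _ fun m _ => (hbrX m).indicator (hMm m)]
    refine Finset.sum_eq_zero fun m _ => ?_
    refine (h.integral_indicator hX hM hXγ m ((hbm m).mul (hrm m)) (hbr m)).trans ?_
    -- The test function collects all that is not a missing profile: the indicator of the event, the
    -- observed factors and the constants K_j. For a fixed pattern the masked vector depends only on
    -- x_obs, hence so does this product.
    have key := integral_mul_dotProduct_sub_misMean hS μ μt hσt m (vecMis β m)
      (g := fun x => b m x * ((∏ i : Obs m, (1 - K i * maskWeight μt σt i x)) *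
        ∏ j : Mis m, K j)) (C := 1) ?_ ?_ ?_
    · rw [← key]
      refine integral_congr_ae (Filter.Eventually.of_forall fun x => ?_)
      simp only [patternWeight_eq, r, Pi.mul_apply]
      ring
    · have := hbm m
      fun_prop
    · intro x
      have hk : ∀ k, 0 ≤ 1 - K k * maskWeight μt σt k x ∧ 1 - K k * maskWeight μt σt k x ≤ 1 :=
        fun k => by
          have h1 := maskWeight_pos μt σt k x
          have h2 := maskWeight_le_one μt σt k x
          have h3 := mul_le_one₀ (hK k).2.le h1.le h2
          have h4 := mul_pos (hK k).1 h1
          constructor <;> linarith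
      have p1 : 0 ≤ ∏ i : Obs m, (1 - K i * maskWeight μt σt i x) :=
        Finset.prod_nonneg fun i _ => (hk i).1
      have p2 : ∏ i : Obs m, (1 - K i * maskWeight μt σt i x) ≤ 1 :=
        Finset.prod_le_one (fun i _ => (hk i).1) fun i _ => (hk i).2
      have p3 : 0 ≤ ∏ j : Mis m, K j := Finset.prod_nonneg fun j _ => (hK j).1.le
      have p4 : ∏ j : Mis m, K j ≤ 1 :=
        Finset.prod_le_one (fun j _ => (hK j).1.le) fun j _ => (hK j).2.le
      rw [abs_of_nonneg (mul_nonneg (hb0 m x).1 (mul_nonneg p1 p3))]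
      exact mul_le_one₀ (hb0 m x).2 (mul_nonneg p1 p3) (mul_le_one₀ p2 p3 p4)
    · intro x y hxy
      have h1 : b m x = b m y := by
        have : x ∈ mask m ⁻¹' B ↔ y ∈ mask m ⁻¹' B := by
          rw [Set.mem_preimage, mask_congr hxy, Set.mem_preimage]
        by_cases hy : y ∈ mask m ⁻¹' B <;> simp only [b, Set.indicator, this, hy]
      have h2 : ∀ i : Obs m, maskWeight μt σt i x = maskWeight μt σt i y := fun i => by
        have : x i = y i := congrFun hxy i
        simp [maskWeight, this]
      simp only [h1, h2]

end SelfMasking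

end MissingData

/-! ### Assembly of the main theorem. -/

theorem proposition2p2 {Ω : Type*} [MeasurableSpace Ω] (P : Measure Ω) [IsProbabilityMeasure P]
    (d : ℕ)
    (X : Ω → EuclideanSpace ℝ (Fin d)) (M : Ω → MissingData.Pattern d) (Y ε : Ω → ℝ)
    (hXm : Measurable X) (hMm : Measurable M) (hεm : Measurable ε)
    -- the linear model
    (β₀ : ℝ) (β : EuclideanSpace ℝ (Fin d)) (σ : ℝ≥0)
    (hY : ∀ ω, Y ω = β₀ + inner ℝ (X ω) β + ε ω)
    (hε : HasLaw ε (gaussianReal 0 (σ ^ 2)) P)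
    (hind : IndepFun ε (fun ω => (X ω, M ω)) P)
    -- Gaussian data
    (μ : EuclideanSpace ℝ (Fin d)) (S : Matrix (Fin d) (Fin d) ℝ) (hS : S.PosDef)
    (hX : HasLaw X (multivariateGaussian μ S) P)
    -- Gaussian self-masking
    (K : Fin d → ℝ) (hK : ∀ k, 0 < K k ∧ K k < 1)
    (μt : EuclideanSpace ℝ (Fin d)) (σt : Fin d → ℝ) (hσt : ∀ k, σt k ≠ 0)
    (hM : MissingData.IsGaussianSelfMasking P X M K μt σt) :
    -- the inverse matrices in the formula exist
    (∀ m : MissingData.Pattern d, IsUnit (MissingData.blockObs S m) ∧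
      IsUnit (MissingData.condCov S m) ∧
      IsUnit (1 + MissingData.blockMis (MissingData.maskCov σt) m *
        (MissingData.condCov S m)⁻¹)) ∧
    -- the conditional expectation of the response given the incomplete vector
    Integrable Y P ∧
    P[Y | MeasurableSpace.comap (fun ω => MissingData.mask (M ω) (X ω)) inferInstance] =ᵐ[P]
      (fun ω => MissingData.selfMaskingPredictor β₀ β μ S μt σt (M ω)
        (MissingData.vecObs (X ω) (M ω))) ∧
    -- the Bayes predictor, as the minimizer of the quadratic risk
    (∃ f, MissingData.IsBayesPredictor P Y (fun ω => MissingData.mask (M ω) (X ω)) f) ∧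
    ∀ f, MissingData.IsBayesPredictor P Y (fun ω => MissingData.mask (M ω) (X ω)) f →
      (fun ω => f (MissingData.mask (M ω) (X ω))) =ᵐ[P]
        fun ω => MissingData.selfMaskingPredictor β₀ β μ S μt σt (M ω)
          (MissingData.vecObs (X ω) (M ω)) := by
  have hZ : Measurable fun ω => MissingData.mask (M ω) (X ω) :=
    MissingData.measurable_mask.comp (hXm.prodMk hMm)
  have hres := fun (B : Set (MissingData.Incomplete d)) (hB : MeasurableSet B) =>
    hM.setIntegral_residual hXm hMm hS hX hK hσt β hB
  -- Square-integrability of the residual does not involve the event, so any choice of it serves.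
  have hrL := (hres Set.univ MeasurableSet.univ).1
  have hεL : MemLp ε 2 P := hε.hasGaussianLaw.memLp_two
  have hε0 : ∫ ω, ε ω ∂P = 0 := by
    rw [hε.integral_eq, integral_id_gaussianReal]
  have hXL : MemLp X 2 P := hX.hasGaussianLaw.memLp_two
  have hYL : MemLp Y 2 P := by
    have : MemLp (fun ω => β₀ + inner ℝ (X ω) β + ε ω) 2 P :=
      ((memLp_const β₀).add (hXL.inner_const β)).add hεL
    exact this.ae_eq (Filter.Eventually.of_forall fun ω => (hY ω).symm)
  set F := MissingData.incompletePredictor β₀ β μ S μt σt with hF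
  have hFm : Measurable F := MissingData.measurable_incompletePredictor β₀ β μ S μt σt
  have hFZ : ∀ ω, F (MissingData.mask (M ω) (X ω)) =
      MissingData.selfMaskingPredictor β₀ β μ S μt σt (M ω) (MissingData.vecObs (X ω) (M ω)) :=
    fun ω => MissingData.incompletePredictor_mask β₀ β μ S μt σt (M ω) (X ω)
  -- The observed parts of the linear model and of the predictor cancel, leaving the noise and the
  -- missing-block residual.
  have hdec : ∀ ω, F (MissingData.mask (M ω) (X ω)) = Y ω -
      (ε ω + MissingData.vecMis β (M ω) ⬝ᵥ (MissingData.vecMis (X ω) (M ω) -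
        MissingData.misMean μ S μt σt (M ω) (MissingData.vecObs (X ω) (M ω)))) := fun ω => by
    rw [hFZ, MissingData.selfMaskingPredictor_eq, hY, real_inner_comm,
      MissingData.inner_eq_vecObs_add_vecMis (M ω), dotProduct_sub]
    ring
  have hFi : Integrable (fun ω => F (MissingData.mask (M ω) (X ω))) P := by
    simp_rw [hdec]
    exact (hYL.sub (hεL.add hrL)).integrable one_le_two
  have hεset : ∀ B : Set (MissingData.Incomplete d), MeasurableSet B →
      ∫ ω in (fun ω => MissingData.mask (M ω) (X ω)) ⁻¹' B, ε ω ∂P = 0 := fun B hB => by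
    have hb : Measurable fun p : EuclideanSpace ℝ (Fin d) × MissingData.Pattern d =>
        B.indicator (fun _ => (1 : ℝ)) (MissingData.mask p.2 p.1) :=
      (measurable_const.indicator hB).comp MissingData.measurable_mask
    have hi := (hind.comp measurable_id hb).integral_fun_mul_eq_mul_integral
      hεm.aestronglyMeasurable (hb.comp (hXm.prodMk hMm)).aestronglyMeasurable
    have h0 : ∫ ω, (id ∘ ε) ω ∂P = 0 := hε0
    rw [h0, zero_mul] at hi
    rw [← integral_indicator (hZ hB), ← hi]
    refine integral_congr_ae (Filter.Eventually.of_forall fun ω => ?_)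
    by_cases hω : MissingData.mask (M ω) (X ω) ∈ B <;> simp [hω]
  have hcond : P[Y | MeasurableSpace.comap (fun ω => MissingData.mask (M ω) (X ω))
      inferInstance] =ᵐ[P] fun ω => F (MissingData.mask (M ω) (X ω)) := by
    symm
    refine ae_eq_condExp_of_forall_setIntegral_eq hZ.comap_le (hYL.integrable one_le_two)
      (fun s _ _ => hFi.integrableOn) ?_
      (hFm.comp (comap_measurable _)).stronglyMeasurable.aestronglyMeasurable
    rintro s ⟨B, hB, rfl⟩ -
    simp_rw [hdec]
    have hsum : Integrable (fun ω => ε ω + MissingData.vecMis β (M ω) ⬝ᵥ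
        (MissingData.vecMis (X ω) (M ω) -
          MissingData.misMean μ S μt σt (M ω) (MissingData.vecObs (X ω) (M ω)))) P :=
      (hεL.add hrL).integrable one_le_two
    rw [integral_sub (hYL.integrable one_le_two).integrableOn hsum.integrableOn,
      integral_add (hεL.integrable one_le_two).integrableOn
      (hrL.integrable one_le_two).integrableOn, hεset B hB, (hres B hB).2]
    simp
  obtain ⟨hbayes, huniq⟩ :=
    MissingData.isBayesPredictor_and_unique_of_condExp hYL hZ hFm hcond
  simp_rw [hFZ] at hcond huniq
  exact ⟨fun m => ⟨(MissingData.posDef_blockObs hS m).isUnit,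
    (MissingData.posDef_condCov hS m).isUnit,
    MissingData.isUnit_one_add_blockMis_maskCov_mul hS hσt m⟩,
    hYL.integrable one_le_two, hcond, ⟨F, hbayes⟩, huniq⟩
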